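/- \textbf{Theorem.} Let $G=(V,E,L)$ be a finite graph with loops: $V$ is a finite set, $E$ is a set of two-element subsets of $V$, and the set of loops $L=L^+\cup L^-$ is partitioned into plus loops $L^+$ and minus loops $L^-$, where a loop $\{i,i\}$ joins a node $i\in V$ to itself. Define $$\mathrm{QP}(G):=\operatorname{conv}\Big\{z\in\mathbb{R}^{V\cup E\cup L}:\ z_{ii}\ge z_i^2\ \ \forall\{i,i\}\in L^+,\quad z_{ii}\le z_i^2\ \ \forall\{i,i\}\in L^-,\quad z_{ij}=z_iz_j\ \ \forall\{i,j\}\in E,\quad z_i\in[0,1]\ \ \forall i\in V\Big\}$$ and $V^+:=\{i\in V:\{i,i\}\in L^+\}$. If $V^+$ is a stable set of $G$, i.e. no two distinct nodes of $V^+$ are joined by an edge in $E$, then $\mathrm{QP}(G)$ is SOC-representable (second-order cone representable): there are integers $r,N\ge 0$, integers $m_k\ge 0$, and affine maps $a_k:\mathbb{R}^{V\cup E\cup L}\times\mathbb{R}^r\to\mathbb{R}^{m_k}$ and $b_k:\mathbb{R}^{V\cup E\cup L}\times\mathbb{R}^r\to\mathbb{R}$ for $k=1,\dots,N$, such that $$\mathrm{QP}(G)=\big\{z:\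 \exists\,y\in\mathbb{R}^r\ \text{ with }\ \|a_k(z,y)\|_2\le b_k(z,y)\ \text{ for all } k=1,\dots,N\big\}.$$ (Constraints with $m_k=0$ are linear inequalities $0\le b_k(z,y)$.) -/

import Mathlib

/-- A graph with signed loops `G = (V, E, L)`, `L = L⁺ ∪ L⁻`: a simple graph `(V, E)` together with
the plus loops and the minus loops. A loop `{i, i}` is recorded by its node `i`; no loop is both a
plus loop and a minus loop. -/
structure LoopGraph (V : Type*) where
  /-- the nodes and the (non-loop) edges -/
  graph : SimpleGraph V
  /-- the set `V⁺` of nodes that carry a plus loop -/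
  plusNodes : Set V
  /-- the set of nodes that carry a minus loop -/
  minusNodes : Set V
  disjoint : Disjoint plusNodes minusNodes

namespace LoopGraph

variable {V : Type*} (G : LoopGraph V)

/-- The index set `V ∪ E ∪ L` (a disjoint union) of the variables. -/
abbrev Coord : Type _ :=
  V ⊕ (G.graph.edgeSet ⊕ (G.plusNodes ∪ G.minusNodes : Set V))

/-- The index of `z_i`. -/
abbrev node (i : V) : G.Coord := Sum.inl i

/-- The index of `z_{ij}`, for an edge `{i, j}`. -/
abbrev edge {i j : V} (h : G.graph.Adj i j) : G.Coord := Sum.inr (Sum.inl ⟨s(i, j), h⟩)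

/-- The index of `z_{ii}`, for a plus loop `{i, i}`. -/
abbrev plusLoop {i : V} (h : i ∈ G.plusNodes) : G.Coord := Sum.inr (Sum.inr ⟨i, Or.inl h⟩)

/-- The index of `z_{ii}`, for a minus loop `{i, i}`. -/
abbrev minusLoop {i : V} (h : i ∈ G.minusNodes) : G.Coord := Sum.inr (Sum.inr ⟨i, Or.inr h⟩)

/-- The feasible set of the lifted box-constrained quadratic program of `G`. -/
def liftedSet : Set (G.Coord → ℝ) :=
  {z | (∀ (i : V) (h : i ∈ G.plusNodes), z (G.plusLoop h) ≥ z (G.node i) ^ 2) ∧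
       (∀ (i : V) (h : i ∈ G.minusNodes), z (G.minusLoop h) ≤ z (G.node i) ^ 2) ∧
       (∀ (i j : V) (h : G.graph.Adj i j), z (G.edge h) = z (G.node i) * z (G.node j)) ∧
       (∀ i : V, z (G.node i) ∈ Set.Icc (0 : ℝ) 1)}

/-- `QP(G)`, the convex hull of the lifted feasible set. -/
def QP : Set (G.Coord → ℝ) := convexHull ℝ G.liftedSet

end LoopGraph

/-- A subset `C` of `ℝ^ι` is second-order cone representable if it is the projection of a set
described by finitely many second-order cone constraints: for some `r` there are finitely many affine
maps `a k : ℝ^ι × ℝ^r → ℝ^(m k)` and `b k : ℝ^ι × ℝ^r → ℝ` such that `x ∈ C` iff some `y ∈ ℝ^r`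
satisfies `‖a k (x, y)‖₂ ≤ b k (x, y)` for all `k`. Linear inequalities are the constraints with
`m k = 0`, and a linear equation is a pair of linear inequalities. -/
def IsSOCRepresentable {ι : Type*} (C : Set (ι → ℝ)) : Prop :=
  ∃ (r N : ℕ) (m : Fin N → ℕ)
    (a : (k : Fin N) → ((ι → ℝ) × (Fin r → ℝ)) →ᵃ[ℝ] EuclideanSpace ℝ (Fin (m k)))
    (b : Fin N → ((ι → ℝ) × (Fin r → ℝ)) →ᵃ[ℝ] ℝ),
    C = {x | ∃ y : Fin r → ℝ, ∀ k, ‖a k (x, y)‖ ≤ b k (x, y)}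

/-! At a node without a plus loop, a lifted point is affine in the node's value up to slack in the
minus loop, so it averages lifted points with that node at 0 or 1 (`eq_combo_moveNode`,
`moveNode_mem`). Hence `QP` is the hull of finitely many pieces, one per binary assignment off
`plusNodes`. By stability every edge has an endpoint of fixed value, so within a piece the edge
equations are linear and only the convex plus-loop constraints remain. The hull is then described by
disjunctive programming: `z` is a sum of homogenized pieces with weights summing to 1. The pieces
are unbounded, but weight-zero terms are recession directions of the whole lifted set, so no closure
is needed. -/

/-- A set described by finitely many second-order cone constraints, without projection. -/
def IsSOCSet {E : Type*} [AddCommGroup E] [Module ℝ E] (D : Set E) : Prop :=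
  ∃ (N : ℕ) (m : Fin N → ℕ) (a : (k : Fin N) → E →ᵃ[ℝ] EuclideanSpace ℝ (Fin (m k)))
    (b : Fin N → E →ᵃ[ℝ] ℝ), D = {x | ∀ k, ‖a k x‖ ≤ b k x}

/-! ### Calculus of second-order cone sets -/

namespace IsSOCSet

variable {E : Type*} [AddCommGroup E] [Module ℝ E]

theorem of_finite {K : Type*} [Finite K] (m : K → ℕ)
    (a : (k : K) → E →ᵃ[ℝ] EuclideanSpace ℝ (Fin (m k))) (b : K → E →ᵃ[ℝ] ℝ) :
    IsSOCSet {x | ∀ k, ‖a k x‖ ≤ b k x} := by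
  obtain ⟨n, ⟨e⟩⟩ := Finite.exists_equiv_fin K
  refine ⟨n, fun k => m (e.symm k), fun k => a (e.symm k), fun k => b (e.symm k), ?_⟩
  ext x
  exact (e.symm.surjective.forall (p := fun k => ‖a k x‖ ≤ b k x))

theorem forall_finite {K : Type*} [Finite K] {P : K → E → Prop}
    (h : ∀ k, IsSOCSet {x | P k x}) : IsSOCSet {x | ∀ k, P k x} := by
  choose N m a b hab using h
  convert of_finite (K := Σ k, Fin (N k)) (fun p => m p.1 p.2) (fun p => a p.1 p.2)
    (fun p => b p.1 p.2) using 1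
  ext x
  have h1 : ∀ k, P k x ↔ ∀ l, ‖a k l x‖ ≤ b k l x := fun k => Set.ext_iff.1 (hab k) x
  simp [h1, Sigma.forall]

theorem and {P Q : E → Prop} (hP : IsSOCSet {x | P x}) (hQ : IsSOCSet {x | Q x}) :
    IsSOCSet {x | P x ∧ Q x} := by
  have h := forall_finite (K := Bool) (P := fun k x => if k then P x else Q x)
    (by rintro (_ | _) <;> simpa)
  simpa [Bool.forall_bool, and_comm] using h

theorem cone {n : ℕ} (a : E →ᵃ[ℝ] EuclideanSpace ℝ (Fin n)) (b : E →ᵃ[ℝ] ℝ) :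
    IsSOCSet {x | ‖a x‖ ≤ b x} := by
  simpa using of_finite (K := Unit) (fun _ => n) (fun _ => a) (fun _ => b)

theorem le (f g : E →ₗ[ℝ] ℝ) (c : ℝ) : IsSOCSet {x | f x ≤ g x + c} := by
  have h := cone (n := 0) (0 : E →ᵃ[ℝ] EuclideanSpace ℝ (Fin 0))
    ((g - f).toAffineMap + AffineMap.const ℝ E c)
  convert h using 2
  ext x
  simp only [AffineMap.coe_zero, Pi.zero_apply, norm_zero, AffineMap.coe_add, Pi.add_apply,
    LinearMap.coe_toAffineMap, LinearMap.sub_apply, AffineMap.const_apply]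
  constructor <;> intro h <;> linarith

theorem linear_le (f g : E →ₗ[ℝ] ℝ) : IsSOCSet {x | f x ≤ g x} := by
  simpa using le f g 0

theorem linear_eq (f g : E →ₗ[ℝ] ℝ) : IsSOCSet {x | f x = g x} := by
  simpa only [le_antisymm_iff] using (linear_le f g).and (linear_le g f)

theorem linear_eq_const (f : E →ₗ[ℝ] ℝ) (c : ℝ) : IsSOCSet {x | f x = c} := by
  convert (le f 0 c).and (le (-f) 0 (-c)) using 2
  ext x
  simp [le_antisymm_iff]

/-- The rotated second-order cone. -/
theorem rotatedCone (f g h : E →ₗ[ℝ] ℝ) :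
    IsSOCSet {x | f x ^ 2 ≤ g x * h x ∧ 0 ≤ g x ∧ 0 ≤ h x} := by
  -- Since `(g + h)² - (g - h)² = 4gh`, the constraint is `‖(2f, g - h)‖ ≤ g + h`.
  let a : E →ₗ[ℝ] EuclideanSpace ℝ (Fin 2) :=
    (WithLp.linearEquiv 2 ℝ (Fin 2 → ℝ)).symm.toLinearMap ∘ₗ
      LinearMap.pi ![(2 : ℝ) • f, g - h]
  have hc := ((cone a.toAffineMap (g + h).toAffineMap).and (linear_le 0 g)).and (linear_le 0 h)
  convert hc using 2
  ext x
  have ha : ‖a x‖ = √((2 * f x) ^ 2 + (g x - h x) ^ 2) := by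
    rw [EuclideanSpace.norm_eq]
    simp [a, Fin.sum_univ_two]
  simp only [LinearMap.coe_toAffineMap, ha, LinearMap.add_apply, LinearMap.zero_apply, and_assoc]
  refine and_congr_left fun hgh => ?_
  rw [Real.sqrt_le_left (add_nonneg hgh.1 hgh.2)]
  constructor <;> intro h <;> nlinarith

theorem convex {D : Set E} (h : IsSOCSet D) : Convex ℝ D := by
  obtain ⟨N, m, a, b, rfl⟩ := h
  intro x hx y hy s t hs ht hst k
  have hxk := hx k
  have hyk := hy k
  rw [Convex.combo_affine_apply hst, Convex.combo_affine_apply hst]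
  calc ‖s • a k x + t • a k y‖ ≤ ‖s • a k x‖ + ‖t • a k y‖ := norm_add_le _ _
    _ = s * ‖a k x‖ + t * ‖a k y‖ := by
      rw [norm_smul, norm_smul, Real.norm_of_nonneg hs, Real.norm_of_nonneg ht]
    _ ≤ s • b k x + t • b k y := by
      simp only [smul_eq_mul]
      gcongr

theorem isSOCRepresentable {ι κ : Type*} [Finite κ] {D : Set ((ι → ℝ) × (κ → ℝ))}
    (h : IsSOCSet D) : IsSOCRepresentable {x | ∃ y, (x, y) ∈ D} := by
  obtain ⟨N, m, a, b, rfl⟩ := h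
  obtain ⟨n, ⟨e⟩⟩ := Finite.exists_equiv_fin κ
  let φ : ((ι → ℝ) × (Fin n → ℝ)) →ᵃ[ℝ] ((ι → ℝ) × (κ → ℝ)) :=
    (LinearMap.prodMap LinearMap.id (LinearMap.funLeft ℝ ℝ e)).toAffineMap
  have hφ : ∀ x y, φ (x, y) = (x, y ∘ e) := fun x y => rfl
  refine ⟨n, N, m, fun k => (a k).comp φ, fun k => (b k).comp φ, ?_⟩
  ext x
  constructor
  · rintro ⟨y, hy⟩
    refine ⟨y ∘ e.symm, fun k => ?_⟩
    simpa [hφ, Function.comp_assoc] using hy k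
  · rintro ⟨y, hy⟩
    exact ⟨y ∘ e, fun k => by simpa [hφ] using hy k⟩

end IsSOCSet

namespace LoopGraph

variable {V : Type*} (G : LoopGraph V)

/-! ### Rounding the nodes without plus loops -/

/-- The lifted points that are binary at all nodes without a plus loop. -/
def binaryLiftedSet : Set (G.Coord → ℝ) :=
  {z ∈ G.liftedSet | ∀ i ∉ G.plusNodes, z (G.node i) = 0 ∨ z (G.node i) = 1}

open Classical in
/-- Move the node `i` of `z` to the value `t`, adjusting the incident edges and the loop at `i`. -/
noncomputable def moveNode (z : G.Coord → ℝ) (i : V) (t : ℝ) : G.Coord → ℝ :=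
  Sum.elim (Function.update (fun j => z (G.node j)) i t)
    (Sum.elim (fun e => (e.1.map (Function.update (fun j => z (G.node j)) i t)).mul)
      (fun l => z (Sum.inr (Sum.inr l)) + if l.1 = i then t - z (G.node i) else 0))

variable {G}

/-- A minus loop survives because `z_ii + t - z_i ≤ z_i² - z_i + t ≤ t = t²`, using `z_i ∈ [0, 1]`
and binary `t`. -/
theorem moveNode_mem {z : G.Coord → ℝ} (hz : z ∈ G.liftedSet) {i : V} (hi : i ∉ G.plusNodes)
    {t : ℝ} (ht : t = 0 ∨ t = 1) : G.moveNode z i t ∈ G.liftedSet := by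
  obtain ⟨hp, hm, -, hn⟩ := hz
  refine ⟨fun j hj => ?_, fun j hj => ?_, fun j k h => ?_, fun j => ?_⟩
  · have hji : j ≠ i := fun h => hi (h ▸ hj)
    simpa [moveNode, hji] using hp j hj
  · by_cases hji : j = i
    · subst hji
      have h1 := hm j hj
      have h2 := hn j
      simp only [moveNode, Sum.elim_inr, Sum.elim_inl, Function.update_self, if_true]
      rcases ht with rfl | rfl <;> nlinarith [h2.1, h2.2]
    · simpa [moveNode, hji] using hm j hj
  · simp [moveNode]
  · by_cases hji : j = i
    · subst hji
      rcases ht with rfl | rfl <;> simp [moveNode]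
    · simpa [moveNode, hji] using hn j

/-- Every coordinate of `moveNode` is affine in `t`, as no edge joins `i` to itself, and `t = z_i`
gives back `z`. -/
theorem eq_combo_moveNode {z : G.Coord → ℝ} (hz : z ∈ G.liftedSet) (i : V) :
    (1 - z (G.node i)) • G.moveNode z i 0 + z (G.node i) • G.moveNode z i 1 = z := by
  obtain ⟨-, -, he, -⟩ := hz
  ext c
  rcases c with j | ⟨e, h⟩ | l
  · by_cases hji : j = i
    · subst hji; simp [moveNode]
    · simp [moveNode, hji]; ring
  · induction e using Sym2.ind with
    | _ j k =>
    have hjk : j ≠ k := G.graph.ne_of_adj h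
    have := he j k h
    simp only [edge] at this
    simp only [Pi.add_apply, Pi.smul_apply, smul_eq_mul, this]
    by_cases hji : j = i
    · subst hji; simp [moveNode, hjk.symm]
    · by_cases hki : k = i
      · subst hki; simp [moveNode, hji]; ring
      · simp [moveNode, hji, hki]; ring
  · simp only [moveNode, Pi.add_apply, Pi.smul_apply, smul_eq_mul, Sum.elim_inr]
    split_ifs <;> ring

theorem liftedSet_subset_convexHull [Finite V] :
    G.liftedSet ⊆ convexHull ℝ G.binaryLiftedSet := by
  classical
  -- `T` contains the nodes off `plusNodes` that may still be fractional.
  have key : ∀ (T : Finset V) (z : G.Coord → ℝ), z ∈ G.liftedSet →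
      (∀ i ∉ G.plusNodes, i ∉ T → z (G.node i) = 0 ∨ z (G.node i) = 1) →
      z ∈ convexHull ℝ G.binaryLiftedSet := by
    intro T
    induction T using Finset.induction_on with
    | empty =>
      intro z hz h
      exact subset_convexHull ℝ _ ⟨hz, fun i hi => h i hi (by simp)⟩
    | insert i T hiT ih =>
      intro z hz h
      by_cases hi : i ∈ G.plusNodes
      · refine ih z hz fun j hj hjT => h j hj ?_
        simp only [Finset.mem_insert, not_or]
        exact ⟨fun hji => hj (hji ▸ hi), hjT⟩
      · have hmem : ∀ t : ℝ, t = 0 ∨ t = 1 →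
            G.moveNode z i t ∈ convexHull ℝ G.binaryLiftedSet := by
          intro t ht
          refine ih _ (moveNode_mem hz hi ht) fun j hj hjT => ?_
          by_cases hji : j = i
          · subst hji; simpa [moveNode] using ht
          · simpa [moveNode, hji] using h j hj (by simp [hji, hjT])
        have hzi := hz.2.2.2 i
        rw [← eq_combo_moveNode hz i]
        exact convex_convexHull ℝ _ (hmem 0 (Or.inl rfl)) (hmem 1 (Or.inr rfl))
          (sub_nonneg.2 hzi.2) hzi.1 (by ring)
  have := Fintype.ofFinite V
  exact fun z hz => key Finset.univ z hz fun i _ hi => absurd (Finset.mem_univ i) hi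

variable (G)

/-! ### Homogenized pieces -/

/-- The homogenization, with variable `t`, of the set of lifted points whose nodes without a plus
loop take the values `s`. -/
def HomogeneousPiece (s : V → ℝ) (t : ℝ) (x : G.Coord → ℝ) : Prop :=
  0 ≤ t ∧
  (∀ i, 0 ≤ x (G.node i)) ∧
  (∀ i, x (G.node i) ≤ t) ∧
  (∀ i : (G.plusNodesᶜ : Set V), x (G.node i) = s i * t) ∧
  (∀ i : G.plusNodes,
    x (G.node i) ^ 2 ≤ t * x (G.plusLoop i.2) ∧ 0 ≤ t ∧ 0 ≤ x (G.plusLoop i.2)) ∧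
  (∀ i : G.minusNodes, x (G.minusLoop i.2) ≤ s i * t) ∧
  (∀ p : {p : V × V // G.graph.Adj p.1 p.2 ∧ p.2 ∉ G.plusNodes},
    x (G.edge p.2.1) = s p.1.2 * x (G.node p.1.1))

variable {G}

theorem homogeneousPiece_isSOCSet [Finite V] {E : Type*} [AddCommGroup E] [Module ℝ E]
    (s : V → ℝ) (t : E →ₗ[ℝ] ℝ) (x : G.Coord → E →ₗ[ℝ] ℝ) :
    IsSOCSet {e | G.HomogeneousPiece s (t e) (fun c => x c e)} := by
  refine .and (.linear_le 0 t) <| .and (.forall_finite fun i => .linear_le 0 _) <|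
    .and (.forall_finite fun i => .linear_le _ t) <|
    .and (.forall_finite fun i => .linear_eq _ (s i • t)) <|
    .and (.forall_finite fun i => .rotatedCone _ _ _) <|
    .and (.forall_finite fun i => .linear_le _ (s i • t)) <|
    .forall_finite fun p => .linear_eq _ (s p.1.2 • x (G.node p.1.1))

theorem HomogeneousPiece.zero (s : V → ℝ) : G.HomogeneousPiece s 0 0 := by
  simp [HomogeneousPiece]

theorem homogeneousPiece_one {z : G.Coord → ℝ} (hz : z ∈ G.liftedSet) (s : V → ℝ)
    (hs : ∀ i ∉ G.plusNodes, z (G.node i) = s i) (hs' : ∀ i ∉ G.plusNodes, s i = 0 ∨ s i = 1) :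
    G.HomogeneousPiece s 1 z := by
  obtain ⟨hp, hm, he, hn⟩ := hz
  refine ⟨zero_le_one, fun i => (hn i).1, fun i => (hn i).2, fun i => by rw [hs i i.2, mul_one],
    fun i => ⟨by simpa using hp i i.2, zero_le_one, (sq_nonneg _).trans (hp i i.2)⟩,
    fun i => ?_, fun p => ?_⟩
  · have hi := Set.disjoint_right.1 G.disjoint i.2
    have h := hm i i.2
    rw [hs i hi] at h
    rcases hs' i hi with h0 | h0 <;> rw [h0] at h ⊢ <;> linarith
  · rw [he _ _ p.2.1, hs _ p.2.2, mul_comm]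

theorem HomogeneousPiece.inv_smul_mem (hstable : G.graph.IsIndepSet G.plusNodes) {s : V → ℝ}
    (hs : ∀ i, s i = 0 ∨ s i = 1) {t : ℝ} {x : G.Coord → ℝ} (h : G.HomogeneousPiece s t x) :
    t⁻¹ • x ∈ G.liftedSet := by
  obtain ⟨ht, h0, h1, hb, hp, hm, he⟩ := h
  rcases ht.eq_or_lt with rfl | ht
  -- Here `0⁻¹ = 0`, and the origin is a lifted point.
  · simp [liftedSet]
  have hb' : ∀ i ∉ G.plusNodes, t⁻¹ * x (G.node i) = s i := fun i hi => by
    rw [hb ⟨i, hi⟩]; field_simp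
  have he' : ∀ (i j : V) (h : G.graph.Adj i j), j ∉ G.plusNodes →
      t⁻¹ * x (G.edge h) = t⁻¹ * x (G.node i) * (t⁻¹ * x (G.node j)) := fun i j h hj => by
    rw [hb' j hj, he ⟨(i, j), h, hj⟩]; ring
  refine ⟨fun i hi => ?_, fun i hi => ?_, fun i j h => ?_, fun i => ⟨?_, ?_⟩⟩ <;>
    simp only [Pi.smul_apply, smul_eq_mul]
  · have h := (hp ⟨i, hi⟩).1
    calc (t⁻¹ * x (G.node i)) ^ 2 = t⁻¹ ^ 2 * x (G.node i) ^ 2 := by ring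
      _ ≤ t⁻¹ ^ 2 * (t * x (G.plusLoop hi)) := by gcongr
      _ = t⁻¹ * x (G.plusLoop hi) := by field_simp
  · rw [hb' i (Set.disjoint_right.1 G.disjoint hi)]
    calc t⁻¹ * x (G.minusLoop hi) ≤ t⁻¹ * (s i * t) := by
          have := hm ⟨i, hi⟩
          gcongr
      _ = s i ^ 2 := by rcases hs i with h | h <;> simp [h, ht.ne']
  · by_cases hj : j ∈ G.plusNodes
    · have hi : i ∉ G.plusNodes := fun hi => hstable hi hj (G.graph.ne_of_adj h) h
      have := he' j i h.symm hi
      rw [mul_comm (t⁻¹ * x (G.node i)), ← this]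
      simp only [edge, Sym2.eq_swap]
    · exact he' i j h hj
  · exact mul_nonneg (by positivity) (h0 i)
  · rw [inv_mul_le_iff₀ ht, mul_one]
    exact h1 i

variable (G)

/-! ### Recession directions -/

/-- The recession directions of the lifted set that do not move the nodes. -/
def IsRecession (d : G.Coord → ℝ) : Prop :=
  (∀ i, d (G.node i) = 0) ∧
  (∀ (i j : V) (h : G.graph.Adj i j), d (G.edge h) = 0) ∧
  (∀ (i : V) (h : i ∈ G.plusNodes), 0 ≤ d (G.plusLoop h)) ∧
  (∀ (i : V) (h : i ∈ G.minusNodes), d (G.minusLoop h) ≤ 0)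

variable {G}

theorem IsRecession.sum {ι : Type*} {S : Finset ι} {d : ι → G.Coord → ℝ}
    (h : ∀ k ∈ S, G.IsRecession (d k)) : G.IsRecession (∑ k ∈ S, d k) := by
  refine ⟨fun i => ?_, fun i j hij => ?_, fun i hi => ?_, fun i hi => ?_⟩ <;>
    rw [Finset.sum_apply]
  · exact Finset.sum_eq_zero fun k hk => (h k hk).1 i
  · exact Finset.sum_eq_zero fun k hk => (h k hk).2.1 i j hij
  · exact Finset.sum_nonneg fun k hk => (h k hk).2.2.1 i hi
  · exact Finset.sum_nonpos fun k hk => (h k hk).2.2.2 i hi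

theorem IsRecession.add_mem {d z : G.Coord → ℝ} (hd : G.IsRecession d) (hz : z ∈ G.liftedSet) :
    z + d ∈ G.liftedSet := by
  obtain ⟨dn, de, dp, dm⟩ := hd
  obtain ⟨hp, hm, he, hn⟩ := hz
  refine ⟨fun i hi => ?_, fun i hi => ?_, fun i j h => ?_, fun i => ?_⟩ <;>
    simp only [Pi.add_apply, dn, add_zero]
  · linarith [hp i hi, dp i hi]
  · linarith [hm i hi, dm i hi]
  · rw [de, add_zero, he]
  · exact hn i

theorem HomogeneousPiece.isRecession (hstable : G.graph.IsIndepSet G.plusNodes) {s : V → ℝ}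
    {x : G.Coord → ℝ} (h : G.HomogeneousPiece s 0 x) : G.IsRecession x := by
  obtain ⟨-, h0, h1, -, hp, hm, he⟩ := h
  have hn : ∀ i, x (G.node i) = 0 := fun i => le_antisymm (h1 i) (h0 i)
  have he' : ∀ (i j : V) (h : G.graph.Adj i j), j ∉ G.plusNodes → x (G.edge h) = 0 :=
    fun i j h hj => by rw [he ⟨(i, j), h, hj⟩, hn, mul_zero]
  refine ⟨hn, fun i j h => ?_, fun i hi => (hp ⟨i, hi⟩).2.2, fun i hi => by simpa using hm ⟨i, hi⟩⟩
  by_cases hj : j ∈ G.plusNodes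
  · have hi : i ∉ G.plusNodes := fun hi => hstable hi hj (G.graph.ne_of_adj h) h
    have := he' j i h.symm hi
    simpa only [edge, Sym2.eq_swap] using this
  · exact he' i j h hj

/-! ### The extended formulation -/

/-- The real vector of a binary assignment. -/
def boolVector (s : V → Bool) (i : V) : ℝ := if s i then 1 else 0

theorem boolVector_eq (s : V → Bool) (i : V) : boolVector s i = 0 ∨ boolVector s i = 1 := by
  unfold boolVector
  split_ifs <;> simp

variable (G)

/-- The extended formulation: `z` is the sum of homogenized pieces whose weights sum to one. -/
def extendedSet [Fintype (V → Bool)] :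
    Set ((G.Coord → ℝ) × (((V → Bool) ⊕ (V → Bool) × G.Coord) → ℝ)) :=
  {e | (∀ s, G.HomogeneousPiece (boolVector s) (e.2 (Sum.inl s)) fun c => e.2 (Sum.inr (s, c))) ∧
    ∑ s, e.2 (Sum.inl s) = 1 ∧ ∀ c, e.1 c = ∑ s, e.2 (Sum.inr (s, c))}

variable {G}

theorem extendedSet_isSOCSet [Finite V] [Fintype (V → Bool)] : IsSOCSet G.extendedSet := by
  let y (k : (V → Bool) ⊕ (V → Bool) × G.Coord) :
      ((G.Coord → ℝ) × (((V → Bool) ⊕ (V → Bool) × G.Coord) → ℝ)) →ₗ[ℝ] ℝ :=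
    LinearMap.proj k ∘ₗ LinearMap.snd ℝ _ _
  refine .and (.forall_finite fun s =>
    homogeneousPiece_isSOCSet _ (y (Sum.inl s)) fun c => y (Sum.inr (s, c))) <| .and ?_ ?_
  · simpa [y] using IsSOCSet.linear_eq_const (∑ s, y (Sum.inl s)) 1
  · refine .forall_finite fun c => ?_
    simpa [y] using IsSOCSet.linear_eq (LinearMap.proj c ∘ₗ LinearMap.fst ℝ _ _)
      (∑ s, y (Sum.inr (s, c)))

theorem QP_eq_projection [Finite V] [Fintype (V → Bool)]
    (hstable : G.graph.IsIndepSet G.plusNodes) : G.QP = {z | ∃ y, (z, y) ∈ G.extendedSet} := by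
  classical
  apply Set.Subset.antisymm
  · have hconv : Convex ℝ {z | ∃ y, (z, y) ∈ G.extendedSet} := by
      have h : {z | ∃ y, (z, y) ∈ G.extendedSet} = LinearMap.fst ℝ _ _ '' G.extendedSet := by
        ext z
        simp
      rw [h]
      exact extendedSet_isSOCSet.convex.linear_image _
    refine convexHull_min (liftedSet_subset_convexHull.trans (convexHull_min ?_ hconv)) hconv
    rintro z ⟨hz, hb⟩
    -- All weight goes to the piece containing `z`; the values of `s₀` on `plusNodes` play no role.
    let s₀ : V → Bool := fun i => decide (z (G.node i) = 1)
    refine ⟨Sum.elim (fun s => if s = s₀ then 1 else 0)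
      (fun p => if p.1 = s₀ then z p.2 else 0), fun s => ?_, ?_, fun c => ?_⟩
    · by_cases hs : s = s₀
      · subst hs
        simp only [Sum.elim_inl, Sum.elim_inr, if_true]
        refine homogeneousPiece_one hz _ (fun i hi => ?_) fun i _ => boolVector_eq _ i
        rcases hb i hi with h | h <;> simp [boolVector, s₀, h]
      · simp only [Sum.elim_inl, Sum.elim_inr, if_neg hs]
        exact HomogeneousPiece.zero _
    · simp
    · simp
  · rintro z ⟨y, hpiece, hsum, hz⟩
    dsimp only at hpiece hsum hz
    set t : (V → Bool) → ℝ := fun s => y (Sum.inl s)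
    set x : (V → Bool) → G.Coord → ℝ := fun s c => y (Sum.inr (s, c)) with hx
    have hd : G.IsRecession (∑ s with t s = 0, x s) := by
      refine IsRecession.sum fun s hs => ?_
      have h := hpiece s
      rw [show y (Sum.inl s) = 0 from (Finset.mem_filter.1 hs).2] at h
      exact h.isRecession hstable
    set d := ∑ s with t s = 0, x s with hd_def
    -- The weight-zero terms are pooled into `d`, which can be added to every point because the
    -- weights sum to 1.
    have hzsum : z = ∑ s, t s • ((t s)⁻¹ • x s + d) := by
      have h1 : ∀ s, t s • ((t s)⁻¹ • x s + d) = (if t s = 0 then 0 else x s) + t s • d := by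
        intro s
        split_ifs with h
        · simp [h]
        · rw [smul_add, smul_inv_smul₀ h]
      rw [Finset.sum_congr rfl fun s _ => h1 s, Finset.sum_add_distrib, ← Finset.sum_smul,
        show ∑ s, t s = 1 from hsum, one_smul, hd_def, Finset.sum_filter,
        ← Finset.sum_add_distrib]
      ext c
      rw [hz c, Finset.sum_apply]
      refine Finset.sum_congr rfl fun s _ => ?_
      split_ifs <;> simp [hx]
    rw [hzsum]
    refine (convex_convexHull ℝ _).sum_mem (fun s _ => (hpiece s).1) hsum fun s _ => ?_
    exact subset_convexHull ℝ _
      (hd.add_mem ((hpiece s).inv_smul_mem hstable (boolVector_eq s)))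

end LoopGraph

theorem mainTheorem2 {V : Type*} [Finite V] (G : LoopGraph V)
    (hstable : G.graph.IsIndepSet G.plusNodes) : IsSOCRepresentable G.QP := by
  have := Fintype.ofFinite (V → Bool)
  rw [LoopGraph.QP_eq_projection hstable]
  exact LoopGraph.extendedSet_isSOCSet.isSOCRepresentable
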